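/- **Theorem (Mayer–Vietoris for morphisms).** Let $\mathcal K$ be a tensor triangulated category: an (essentially small) triangulated category with translation $T$ and a symmetric monoidal structure $\otimes$ with unit $\mathbb 1$, such that $a\otimes-$ and $-\otimes b$ are exact for all $a,b$, the two resulting natural identifications $T(a)\otimes T(b)\cong T^2(a\otimes b)$ differing by the sign $-1$. Assume that $\mathcal K$ is idempotent complete and strongly closed, i.e. there is a functor $\underline{\hom}:\mathcal K^{op}\times\mathcal K\to\mathcal K$, exact in each variable, with natural isomorphisms $\operatorname{Hom}(a\otimes b,c)\cong\operatorname{Hom}(a,\underline{\hom}(b,c))$, such that the natural morphism $\underline{\hom}(a,\mathbb 1)\otimes b\to\underline{\hom}(a,b)$ is an isomorphism for all $a,b$. Let $\operatorname{Spc}(\mathcal K)$ be the set of prime ideals of $\mathcal K$ (proper thick triangulated $\otimes$-ideals $\mathcal P$ such that $a\otimes b\in\mathcal P$ implies $a\in\mathcal P$ or $b\in\mathcal P$), with the topology having the sets $\{\mathcal P\mid a\in\mathcal P\}$, $a\in\mathcal K$, as a basis, and let $\operatorname{supp}(a)=\{\mathcal P\mid a\notin\mathcal P\}$. For $Y\subset\operatorname{Spc}(\mathcal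 K)$ let $\mathcal K_Y$ be the full subcategory of the objects $a$ with $\operatorname{supp}(a)\subset Y$. For $U\subset\operatorname{Spc}(\mathcal K)$ with complement $Z$, let $\operatorname{Mor}_U(a,b)$ be the group of morphisms from $a$ to $b$ in the Verdier quotient $\mathcal K/\mathcal K_Z$, and call a morphism of $\mathcal K$ a $U$-isomorphism if its cone lies in $\mathcal K_Z$. Suppose that $\operatorname{Spc}(\mathcal K)=U_1\cup U_2$ with $U_1,U_2$ open and quasi-compact, and let $Z_i$ be the complement of $U_i$. 1. Every $U_1\cap U_2$-isomorphism $s:x\to a$ fits into a distinguished triangle $$x\xrightarrow{\;s\;}a\xrightarrow{\binom{\alpha}{\beta}}c_1\oplus c_2\xrightarrow{(\gamma\ \delta)}T(x)\qquad\text{with } c_1\in\mathcal K_{Z_1},\ c_2\in\mathcal K_{Z_2}.\tag{$*$}$$ 2. There is exactly one family of group homomorphisms $\partial:\operatorname{Mor}_{U_1\cap U_2}(a,b)\to\operatorname{Hom}_{\mathcal K}(a,T(b))$, for $a,b\in\mathcal K$, such that $$\partial(f s^{-1})=T(f)\circ\gamma\circ\alpha=-\,T(f)\circ\delta\circ\beta$$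 for every fraction $a\xleftarrow{s}x\xrightarrow{f}b$, $s$ a $U_1\cap U_2$-isomorphism, and every choice of a triangle $(*)$. That is, $\partial$ is well defined. 3. For all $a,b\in\mathcal K$ there is a long exact sequence of abelian groups, infinite in both directions, $$\cdots\to\operatorname{Mor}_{U_1\cap U_2}(Ta,b)\xrightarrow{\partial}\operatorname{Hom}_{\mathcal K}(a,b)\to\operatorname{Mor}_{U_1}(a,b)\oplus\operatorname{Mor}_{U_2}(a,b)\to\operatorname{Mor}_{U_1\cap U_2}(a,b)\xrightarrow{\partial}\operatorname{Hom}_{\mathcal K}(a,Tb)\to\cdots$$ continuing to the right with $(a,T^nb)$ and to the left with $(T^na,b)$, $n\ge 0$. The unlabelled maps are the pair of restrictions and the difference of the two restrictions to $U_1\cap U_2$; in the part to the left of $\operatorname{Hom}_{\mathcal K}(a,b)$, the map $\partial:\operatorname{Mor}_{U_1\cap U_2}(T^{n+1}a,b)\to\operatorname{Hom}_{\mathcal K}(T^na,b)$ is the homomorphism of 2. followed by $T^{-1}:\operatorname{Hom}_{\mathcal K}(T^{n+1}a,Tb)\cong\operatorname{Hom}_{\mathcal K}(T^na,b)$. -/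

import Mathlib

open CategoryTheory Category Limits Pretriangulated MonoidalCategory
open scoped Pretriangulated.Opposite ZeroObject

namespace TTGeometry

universe v u

section TensorTriangulated

variable (K : Type u) [Category.{v} K] [HasZeroObject K] [HasShift K ℤ] [Preadditive K]
  [∀ n : ℤ, (shiftFunctor K n).Additive] [Pretriangulated K]
  [MonoidalCategory K] [SymmetricCategory K]

/-- A tensor triangulated category: a triangulated category with a symmetric monoidal structure
such that `a ⊗ -` and `- ⊗ b` are exact. The field `commShift` holds the natural isomorphisms
`a ⊗ T b ≅ T (a ⊗ b)` and `T a ⊗ b ≅ T (a ⊗ b)`; the two ways to identify `T a ⊗ T b` with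
`T (T (a ⊗ b))` that they give differ by the sign `-1`. -/
class TensorTriangulated [IsTriangulated K] where
  commShift : (curriedTensor K).CommShift₂Int
  exact_left (a : K) : ((curriedTensor K).obj a).IsTriangulated
  exact_right (b : K) : ((curriedTensor K).flip.obj b).IsTriangulated

attribute [reducible] TensorTriangulated.commShift
attribute [instance] TensorTriangulated.commShift TensorTriangulated.exact_left
  TensorTriangulated.exact_right

variable {K} in
/-- The natural morphism `D a ⊗ b ⟶ hom(a, b)`, where `D a = hom(a, 𝟙)`. It is adjoint to
`a ⊗ (D a ⊗ b) ≅ (a ⊗ D a) ⊗ b ⟶ 𝟙 ⊗ b ≅ b`. -/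
def dualTensorToHom [MonoidalClosed K] (a b : K) :
    ((ihom a).obj (𝟙_ K)) ⊗ b ⟶ (ihom a).obj b :=
  MonoidalClosed.curry
    ((α_ a ((ihom a).obj (𝟙_ K)) b).inv ≫ ((ihom.ev a).app (𝟙_ K) ▷ b) ≫ (λ_ b).hom)

/-- A tensor triangulated category is strongly closed if it has an internal hom
`Kᵒᵖ ⥤ K ⥤ K`, right adjoint to the tensor product and exact in each variable, for which every
object is strongly dualizable. -/
class StronglyClosed : Prop where
  exists_internalHom : ∃ _ : MonoidalClosed K,
    (∀ a : Kᵒᵖ, ∃ _ : (MonoidalClosed.internalHom.obj a : K ⥤ K).CommShift ℤ,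
      (MonoidalClosed.internalHom.obj a : K ⥤ K).IsTriangulated) ∧
    (∀ c : K, ∃ _ : (MonoidalClosed.internalHom.flip.obj c : Kᵒᵖ ⥤ K).CommShift ℤ,
      (MonoidalClosed.internalHom.flip.obj c : Kᵒᵖ ⥤ K).IsTriangulated) ∧
    ∀ a b : K, IsIso (dualTensorToHom a b)

end TensorTriangulated

section Spectrum

variable (K : Type u) [Category.{v} K] [HasZeroObject K] [HasShift K ℤ] [Preadditive K]
  [∀ n : ℤ, (shiftFunctor K n).Additive] [Pretriangulated K] [MonoidalCategory K]

/-- The spectrum of `K`: the prime ideals of `K`, that is, the proper strictly full thick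
triangulated subcategories which are `⊗`-ideals and are prime for `⊗`. -/
@[ext]
structure Spc where
  carrier : ObjectProperty K
  triangulated : carrier.IsTriangulated
  closedUnderIso : carrier.IsClosedUnderIsomorphisms
  thick (a b : K) : carrier (a ⊞ b) → carrier a ∧ carrier b
  ideal (a b : K) : carrier a → carrier (a ⊗ b)
  prime (a b : K) : carrier (a ⊗ b) → carrier a ∨ carrier b
  proper : ∃ a : K, ¬ carrier a

attribute [instance] Spc.triangulated Spc.closedUnderIso

/-- The Zariski topology: the sets `{P | a ∈ P}`, for `a` in `K`, are a basis. -/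
instance : TopologicalSpace (Spc K) :=
  TopologicalSpace.generateFrom (Set.range fun a : K => {P : Spc K | P.carrier a})

variable {K}

/-- The support of an object. -/
def supp (a : K) : Set (Spc K) := {P | ¬ P.carrier a}

/-- The full subcategory `K_Y` of the objects supported on `Y`. -/
def supportedOn (Y : Set (Spc K)) : ObjectProperty K := fun a => supp a ⊆ Y

lemma supportedOn_iff (Y : Set (Spc K)) (a : K) :
    supportedOn Y a ↔ ∀ P : Spc K, P ∉ Y → P.carrier a := by
  constructor
  · intro h P hP
    by_contra hn
    exact hP (h hn)
  · intro h P hP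
    by_contra hn
    exact hP (h P hn)

instance (Y : Set (Spc K)) : (supportedOn Y).IsClosedUnderIsomorphisms where
  of_iso e h := by
    rw [supportedOn_iff] at h ⊢
    exact fun P hP => P.carrier.prop_of_iso e (h P hP)

instance (Y : Set (Spc K)) : (supportedOn Y).IsTriangulated where
  exists_zero := ⟨0, isZero_zero K, (supportedOn_iff Y 0).2 fun P _ => P.carrier.prop_zero⟩
  isStableUnderShiftBy n := ⟨fun a h => by
    rw [supportedOn_iff] at h
    exact (supportedOn_iff Y (a⟦n⟧)).2 fun P hP => P.carrier.le_shift n _ (h P hP)⟩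
  toIsTriangulatedClosed₂ := .mk' fun T hT h₁ h₃ => by
    rw [supportedOn_iff] at h₁ h₃ ⊢
    exact fun P hP => P.carrier.ext_of_isTriangulatedClosed₂ T hT (h₁ P hP) (h₃ P hP)

/-- `U`-isomorphisms: the morphisms of `K` whose cone is supported outside `U`. -/
abbrev uIso (U : Set (Spc K)) : MorphismProperty K := (supportedOn Uᶜ).trW

lemma uIso_mono {U V : Set (Spc K)} (h : U ⊆ V) : uIso V ≤ uIso U :=
  (supportedOn Vᶜ).trW_monotone (Q := supportedOn Uᶜ)
    fun _ ha => Set.Subset.trans ha (Set.compl_subset_compl.2 h)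

end Spectrum

section Mor

variable {K : Type u} [Category.{v} K] [HasZeroObject K] [HasShift K ℤ] [Preadditive K]
  [∀ n : ℤ, (shiftFunctor K n).Additive] [Pretriangulated K] [MonoidalCategory K]

/-- The Verdier quotient of `K` by the objects supported outside `U`. -/
abbrev Loc (U : Set (Spc K)) : Type u := (uIso U).Localization

/-- The restriction functor from `K` to the Verdier quotient over `U`. -/
abbrev rho (U : Set (Spc K)) : K ⥤ Loc U := (uIso U).Q

/-- Morphisms from `a` to `b` over `U`. -/
abbrev Mor (U : Set (Spc K)) (a b : K) : Type (max u v) := (rho U).obj a ⟶ (rho U).obj b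

/-- The localization functor from the quotient over `V` to the quotient over `U`, for `U ⊆ V`. -/
noncomputable def rhoLoc {U V : Set (Spc K)} (h : U ⊆ V) : Loc V ⥤ Loc U :=
  Localization.Construction.lift (rho U) fun _ _ s hs =>
    Localization.inverts (rho U) (uIso U) s (uIso_mono h s hs)

lemma rho_comp_rhoLoc {U V : Set (Spc K)} (h : U ⊆ V) : rho V ⋙ rhoLoc h = rho U :=
  Localization.Construction.fac _ _

variable [IsTriangulated K]

instance {U V : Set (Spc K)} (h : U ⊆ V) : (rhoLoc h).Additive := by
  rw [Localization.functor_additive_iff (rho V) (uIso V) (rhoLoc h), rho_comp_rhoLoc h]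
  infer_instance

/-- The restriction of morphisms of `K` to `U`. -/
noncomputable def resHom (U : Set (Spc K)) (a b : K) : (a ⟶ b) →+ Mor U a b := (rho U).mapAddHom

/-- The restriction of morphisms over `V` to `U`, for `U ⊆ V`. -/
noncomputable def resMor {U V : Set (Spc K)} (h : U ⊆ V) (a b : K) : Mor V a b →+ Mor U a b :=
  (rhoLoc h).mapAddHom (X := (rho V).obj a) (Y := (rho V).obj b)

variable (U₁ U₂ : Set (Spc K))

/-- The pair of restrictions of a morphism of `K` to `U₁` and `U₂`. -/
noncomputable def resPair (a b : K) : (a ⟶ b) →+ Mor U₁ a b × Mor U₂ a b :=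
  (resHom U₁ a b).prod (resHom U₂ a b)

/-- The difference of the restrictions to `U₁ ∩ U₂`. -/
noncomputable def resDiff (a b : K) : Mor U₁ a b × Mor U₂ a b →+ Mor (U₁ ∩ U₂) a b :=
  (resMor Set.inter_subset_left a b).comp (AddMonoidHom.fst _ _) -
    (resMor Set.inter_subset_right a b).comp (AddMonoidHom.snd _ _)

/-- The morphism `f s⁻¹` over `U` represented by a fraction `a ←s- x -f→ b`. -/
noncomputable def fracMor {U : Set (Spc K)} {a b : K} (φ : (uIso U).RightFraction a b) :
    Mor U a b :=
  φ.map (rho U) (Localization.inverts (rho U) (uIso U))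

/-- A distinguished triangle `x -s→ a ⟶ c₁ ⊞ c₂ ⟶ T x` on `s` in which `cᵢ` is supported
on the complement of `Uᵢ`. -/
structure ConeSplitting {x a : K} (s : x ⟶ a) where
  c₁ : K
  c₂ : K
  supp₁ : supportedOn U₁ᶜ c₁
  supp₂ : supportedOn U₂ᶜ c₂
  α : a ⟶ c₁
  β : a ⟶ c₂
  γ : c₁ ⟶ x⟦(1 : ℤ)⟧
  δ : c₂ ⟶ x⟦(1 : ℤ)⟧
  distinguished : Triangle.mk s (biprod.lift α β) (biprod.desc γ δ) ∈ distTriang K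

/-- The homomorphisms `∂ : Mor_{U₁ ∩ U₂}(a, b) ⟶ Hom(a, T b)` are given by the construction of
the connecting homomorphism: for every fraction `f s⁻¹` and every splitting of the cone of `s`
as above, `∂ (f s⁻¹) = T f ∘ γ ∘ α = - T f ∘ δ ∘ β`. -/
def IsConnecting (del : ∀ a b : K, Mor (U₁ ∩ U₂) a b →+ (a ⟶ b⟦(1 : ℤ)⟧)) : Prop :=
  ∀ (a b : K) (φ : (uIso (U₁ ∩ U₂)).RightFraction a b) (σ : ConeSplitting U₁ U₂ φ.s),
    del a b (fracMor φ) = σ.α ≫ σ.γ ≫ φ.f⟦(1 : ℤ)⟧' ∧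
    del a b (fracMor φ) = -(σ.β ≫ σ.δ ≫ φ.f⟦(1 : ℤ)⟧')

/-- The inverse `Hom(T a, T b) ⟶ Hom(a, b)` of the isomorphism induced by the translation. -/
noncomputable def unshiftHom (a b : K) : (a⟦(1 : ℤ)⟧ ⟶ b⟦(1 : ℤ)⟧) →+ (a ⟶ b) where
  toFun f := (shiftFunctor K (1 : ℤ)).preimage f
  map_zero' := (shiftFunctor K (1 : ℤ)).map_injective (by simp)
  map_add' f g := (shiftFunctor K (1 : ℤ)).map_injective (by simp [Functor.map_add])

/-- The iterated translation `Tⁿ a`. -/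
def iterShift : ℕ → K → K
  | 0, a => a
  | n + 1, a => (iterShift n a)⟦(1 : ℤ)⟧

/-- The connecting homomorphism `T⁻¹ ∘ ∂ : Mor_{U₁ ∩ U₂}(T a, b) ⟶ Hom(a, b)`. -/
noncomputable def delLeft (del : ∀ a b : K, Mor (U₁ ∩ U₂) a b →+ (a ⟶ b⟦(1 : ℤ)⟧)) (a b : K) :
    Mor (U₁ ∩ U₂) (a⟦(1 : ℤ)⟧) b →+ (a ⟶ b) :=
  (unshiftHom a b).comp (del (a⟦(1 : ℤ)⟧) b)

/-- The half of the Mayer-Vietoris sequence of `(a, b)` from `Hom(a, b)` on to the right,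
`⋯ ⟶ Hom(a, Tⁿ b) ⟶ Mor_{U₁}(a, Tⁿ b) ⊕ Mor_{U₂}(a, Tⁿ b) ⟶ Mor_{U₁ ∩ U₂}(a, Tⁿ b)
⟶ Hom(a, Tⁿ⁺¹ b) ⟶ ⋯` for `n ≥ 0`, is exact at all its terms but the first. -/
def ExactRight (del : ∀ a b : K, Mor (U₁ ∩ U₂) a b →+ (a ⟶ b⟦(1 : ℤ)⟧)) (a b : K) : Prop :=
  ∀ n : ℕ,
    Function.Exact (resPair U₁ U₂ a (iterShift n b)) (resDiff U₁ U₂ a (iterShift n b)) ∧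
    Function.Exact (resDiff U₁ U₂ a (iterShift n b)) (del a (iterShift n b)) ∧
    Function.Exact (del a (iterShift n b)) (resPair U₁ U₂ a (iterShift (n + 1) b))

/-- The half of the Mayer-Vietoris sequence of `(a, b)` up to the term `Hom(a, b)`,
`⋯ ⟶ Mor_{U₁}(Tⁿ⁺¹ a, b) ⊕ Mor_{U₂}(Tⁿ⁺¹ a, b) ⟶ Mor_{U₁ ∩ U₂}(Tⁿ⁺¹ a, b) ⟶ Hom(Tⁿ a, b)
⟶ Mor_{U₁}(Tⁿ a, b) ⊕ Mor_{U₂}(Tⁿ a, b) ⟶ ⋯` for `n ≥ 0`, is exact at all its terms, the last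
one `Hom(a, b)` included (with its map to `Mor_{U₁}(a, b) ⊕ Mor_{U₂}(a, b)`). -/
def ExactLeft (del : ∀ a b : K, Mor (U₁ ∩ U₂) a b →+ (a ⟶ b⟦(1 : ℤ)⟧)) (a b : K) : Prop :=
  ∀ n : ℕ,
    Function.Exact (resPair U₁ U₂ (iterShift (n + 1) a) b)
      (resDiff U₁ U₂ (iterShift (n + 1) a) b) ∧
    Function.Exact (resDiff U₁ U₂ (iterShift (n + 1) a) b)
      (delLeft U₁ U₂ del (iterShift n a) b) ∧
    Function.Exact (delLeft U₁ U₂ del (iterShift n a) b) (resPair U₁ U₂ (iterShift n a) b)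

end Mor

end TTGeometry

/-!
# Mayer-Vietoris for morphisms in a tensor triangulated category

Rigidity enters through two facts. An object `a` is a direct summand of `a ⊗ D a ⊗ a`, so every
thick `⊗`-ideal is radical; and a morphism `a ⟶ b` factors through `a ⊗ D a ⊗ b`. By Zorn's lemma
a radical ideal is the intersection of the primes that contain it (`exists_prime_of_not_mem`).
Applied to the zero ideal, this shows that there are no nonzero morphisms between objects with
disjoint supports (`hom_eq_zero_of_disjoint`).

Let `Z₁` and `Z₂` be the complements of `U₁` and `U₂`. They are disjoint, and they are supports of
objects because `U₁` and `U₂` are quasi-compact open (`exists_supp_eq_compl`). The direct summands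
of the extensions of `K_{Z₁}` by `K_{Z₂}` form a thick ideal: extensions in the other order split,
by orthogonality. The primes that contain this ideal are those outside `Z₁ ∪ Z₂`, so it is all of
`K_{Z₁ ∪ Z₂}`; as idempotents split, each of its objects is a sum `c₁ ⊞ c₂`
(`exists_iso_biprod_of_supportedOn_union`). In particular the cone of a `U₁ ∩ U₂`-isomorphism
splits (`nonempty_coneSplitting`).

The morphism `T f ∘ γ ∘ α` attached to a fraction `f s⁻¹` is unchanged when `s` is refined, since a
morphism `c₁' ⊞ c₂' ⟶ c₁ ⊞ c₂` between the cones is diagonal (`ConeSplitting.α_γ_comp_shift`); so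
it depends on `f s⁻¹` only, and additivity follows by taking common denominators. For exactness,
the fibers `x₁`, `x₂` of `α` and `β` are compared with the fiber `x` of `(α, β)`. If `T f ∘ γ ∘ α`
vanishes, `f` is a sum of morphisms that extend to `x₁` and to `x₂`
(`ConeSplitting.exists_eq_comp_fiber_add`), which gives exactness at `Mor_{U₁ ∩ U₂}`; morphisms on
`x₁` and `x₂` that agree on `x` have a common extension to `a`
(`ConeSplitting.exists_common_extension`), which gives exactness at `Mor_{U₁} ⊕ Mor_{U₂}`.
-/

namespace TTGeometry

universe v u

/-! ### Thick tensor ideals and primes -/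

section ThickIdeals

variable {K : Type u} [Category.{v} K] [HasZeroObject K] [HasShift K ℤ] [Preadditive K]
  [∀ n : ℤ, (shiftFunctor K n).Additive] [Pretriangulated K] [MonoidalCategory K]

/-- A thick triangulated `⊗`-ideal. Thickness is expressed by stability under retracts, which
implies closure under isomorphisms. -/
structure IsThickIdeal (I : ObjectProperty K) : Prop where
  isTriangulated : I.IsTriangulated
  isStableUnderRetracts : I.IsStableUnderRetracts
  tensor (a b : K) : I a → I (a ⊗ b)

/-- In a triangulated category a retract is a direct summand, so primes are stable under
retracts. -/
instance Spc.isStableUnderRetracts (P : Spc K) : P.carrier.IsStableUnderRetracts where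
  of_retract {x y} r hy := by
    obtain ⟨z, g, h, hT⟩ := distinguished_cocone_triangle r.i
    have hm : Mono r.i := inferInstance
    obtain ⟨e, -⟩ := exists_iso_binaryBiproduct_of_distTriang _ hT
      ((Triangle.mor₃_eq_zero_iff_mono₁ _ hT).2 hm)
    exact (P.thick _ _ (P.carrier.prop_of_iso e hy)).1

instance supportedOn_isStableUnderRetracts (Y : Set (Spc K)) :
    (supportedOn Y).IsStableUnderRetracts where
  of_retract r h := by
    rw [supportedOn_iff] at h ⊢
    exact fun P hP => P.carrier.prop_of_retract r (h P hP)

lemma supportedOn_tensor {Y : Set (Spc K)} {a : K} (b : K) (h : supportedOn Y a) :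
    supportedOn Y (a ⊗ b) := by
  rw [supportedOn_iff] at h ⊢
  exact fun P hP => P.ideal a b (h P hP)

/-- In a strongly closed category, the evaluation `a ⊗ D a ⟶ 𝟙` and the coevaluation
`𝟙 ⟶ D a ⊗ a` satisfy the first triangle identity. -/
lemma exists_dual [StronglyClosed K] (a : K) :
    ∃ (d : K) (η : 𝟙_ K ⟶ d ⊗ a) (ε : a ⊗ d ⟶ 𝟙_ K),
      (ρ_ a).inv ≫ a ◁ η ≫ (α_ a d a).inv ≫ ε ▷ a ≫ (λ_ a).hom = 𝟙 a := by
  obtain ⟨_, -, -, h⟩ := StronglyClosed.exists_internalHom (K := K)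
  have := h a a
  refine ⟨(ihom a).obj (𝟙_ K),
    MonoidalClosed.curry (ρ_ a).hom ≫ inv (dualTensorToHom a a), (ihom.ev a).app (𝟙_ K), ?_⟩
  have key : a ◁ (MonoidalClosed.curry (ρ_ a).hom ≫ inv (dualTensorToHom a a)) ≫
      ((α_ a ((ihom a).obj (𝟙_ K)) a).inv ≫ ((ihom.ev a).app (𝟙_ K) ▷ a) ≫ (λ_ a).hom) =
      (ρ_ a).hom := by
    apply MonoidalClosed.curry_injective
    rw [MonoidalClosed.curry_natural_left]
    change _ ≫ dualTensorToHom a a = _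
    simp
  rw [key, Iso.inv_hom_id]

/-- The union of a nonempty chain of thick ideals is a thick ideal. -/
lemma isThickIdeal_chain {C : Set (ObjectProperty K)} (hC : IsChain (· ≤ ·) C)
    (hC' : C.Nonempty) (h : ∀ I ∈ C, IsThickIdeal I) :
    IsThickIdeal (fun x => ∃ I ∈ C, I x) where
  isTriangulated := by
    obtain ⟨I₀, hI₀⟩ := hC'
    exact
    { exists_zero := by
        have := (h I₀ hI₀).isTriangulated
        have := (h I₀ hI₀).isStableUnderRetracts
        exact ⟨0, isZero_zero K, I₀, hI₀, I₀.prop_zero⟩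
      isStableUnderShiftBy := fun n => ⟨fun x ⟨I, hI, hx⟩ => by
        have := (h I hI).isTriangulated
        exact ⟨I, hI, I.le_shift n _ hx⟩⟩
      ext₂' := by
        rintro T hT ⟨I, hI, h₁⟩ ⟨J, hJ, h₃⟩
        obtain ⟨L, hL, hIL, hJL⟩ := hC.directedOn I hI J hJ
        have := (h L hL).isTriangulated
        have := (h L hL).isStableUnderRetracts
        exact ObjectProperty.le_isoClosure _ _
          ⟨L, hL, L.ext_of_isTriangulatedClosed₂ T hT (hIL _ h₁) (hJL _ h₃)⟩ }
  isStableUnderRetracts := ⟨fun r ⟨I, hI, hx⟩ => by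
    have := (h I hI).isStableUnderRetracts
    exact ⟨I, hI, I.prop_of_retract r hx⟩⟩
  tensor a b := fun ⟨I, hI, hx⟩ => ⟨I, hI, (h I hI).tensor a b hx⟩

lemma isZero_tensor [IsTriangulated K] [TensorTriangulated K] {a : K} (h : IsZero a) (b : K) :
    IsZero (a ⊗ b) :=
  ((curriedTensor K).flip.obj b).map_isZero h

/-- A morphism `a ⟶ b` factors through `a ⊗ D a ⊗ b`. -/
lemma hom_eq_zero_of_isZero_tensor [StronglyClosed K] {a b : K}
    (hz : ∀ d : K, IsZero (a ⊗ d ⊗ b)) (f : a ⟶ b) : f = 0 := by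
  obtain ⟨d, η, ε, hd⟩ := exists_dual a
  have h₁ : f = ((ρ_ a).inv ≫ a ◁ η) ≫ a ◁ d ◁ f ≫ (α_ a d b).inv ≫ ε ▷ b ≫ (λ_ b).hom := by
    have : a ◁ d ◁ f ≫ (α_ a d b).inv ≫ ε ▷ b ≫ (λ_ b).hom =
        (α_ a d a).inv ≫ ε ▷ a ≫ (λ_ a).hom ≫ f := by
      rw [← leftUnitor_naturality, ← whisker_exchange_assoc]
      simp
    rw [this]
    simpa using (hd =≫ f).symm
  rw [h₁, (hz d).eq_of_src ((α_ a d b).inv ≫ ε ▷ b ≫ (λ_ b).hom) 0, comp_zero, comp_zero]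

lemma isThickIdeal_isZero [IsTriangulated K] [TensorTriangulated K] :
    IsThickIdeal (IsZero : ObjectProperty K) where
  isTriangulated :=
    { exists_zero := ⟨0, isZero_zero K, isZero_zero K⟩
      isStableUnderShiftBy := fun n => ⟨fun _ h => (shiftFunctor K n).map_isZero h⟩
      ext₂' := fun T hT h₁ h₃ =>
        ObjectProperty.le_isoClosure _ _ (T.isZero₂_of_isZero₁₃ hT h₁ h₃) }
  isStableUnderRetracts := ⟨fun r h => by
    rw [IsZero.iff_id_eq_zero, ← r.retract, h.eq_of_tgt r.i 0, zero_comp]⟩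
  tensor _ b h := isZero_tensor h b

variable [SymmetricCategory K]

/-- Every thick ideal is radical: `a` is a direct summand of `a ⊗ D a ⊗ a`. -/
lemma IsThickIdeal.of_tensor_self [StronglyClosed K] {I : ObjectProperty K} (hI : IsThickIdeal I)
    {a : K} (h : I (a ⊗ a)) : I a := by
  have := hI.isStableUnderRetracts
  obtain ⟨d, η, ε, hd⟩ := exists_dual a
  have h₁ : I (a ⊗ d ⊗ a) :=
    I.prop_of_iso (α_ a a d ≪≫ whiskerLeftIso a (β_ a d)) (hI.tensor _ d h)
  refine I.prop_of_retract (Y := a ⊗ d ⊗ a)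
    ⟨(ρ_ a).inv ≫ a ◁ η, (α_ a d a).inv ≫ ε ▷ a ≫ (λ_ a).hom, ?_⟩ h₁
  simpa using hd

variable [IsTriangulated K] [TensorTriangulated K]

/-- The ideal quotient `(I : c)` is a thick ideal: it is the inverse image of `I` under the exact
functor `- ⊗ c`. -/
lemma IsThickIdeal.colon {I : ObjectProperty K} (hI : IsThickIdeal I) (c : K) :
    IsThickIdeal (fun x => I (x ⊗ c)) := by
  have := hI.isTriangulated
  have := hI.isStableUnderRetracts
  exact
  { isTriangulated :=
      inferInstanceAs (I.inverseImage ((curriedTensor K).flip.obj c)).IsTriangulated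
    isStableUnderRetracts :=
      ⟨fun r h => I.prop_of_retract (r.map ((curriedTensor K).flip.obj c)) h⟩
    tensor := fun a b h => I.prop_of_iso
      (α_ a c b ≪≫ whiskerLeftIso a (β_ c b) ≪≫ (α_ a b c).symm) (hI.tensor _ b h) }

/-- A thick ideal that is maximal among those that omit `a` is prime. -/
lemma exists_prime_of_not_mem [StronglyClosed K] {I : ObjectProperty K} (hI : IsThickIdeal I)
    {a : K} (ha : ¬ I a) : ∃ P : Spc K, I ≤ P.carrier ∧ ¬ P.carrier a := by
  obtain ⟨M, hIM, hM⟩ := zorn_le_nonempty₀ {J : ObjectProperty K | IsThickIdeal J ∧ ¬ J a}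
    (fun C hC hC' J hJ => ⟨fun x => ∃ I ∈ C, I x,
      ⟨isThickIdeal_chain hC' ⟨J, hJ⟩ fun I hI => (hC hI).1,
        fun ⟨I, hI, hIa⟩ => (hC hI).2 hIa⟩, fun I hI x hx => ⟨I, hI, hx⟩⟩) I ⟨hI, ha⟩
  have hMt := hM.prop.1
  have := hMt.isTriangulated
  have := hMt.isStableUnderRetracts
  -- by maximality, a quotient `(M : c)` that is larger than `M` contains `a`
  have key (x c : K) (hx : M (x ⊗ c)) : M x ∨ M (a ⊗ c) := by
    by_contra! hn
    exact hn.1 (hM.le_of_ge (y := fun y => M (y ⊗ c)) ⟨hMt.colon c, hn.2⟩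
      (fun y hy => hMt.tensor y c hy) x hx)
  refine ⟨⟨M, inferInstance, inferInstance, fun x y h => ⟨?_, ?_⟩, hMt.tensor, fun x y h => ?_,
    a, hM.prop.2⟩, hIM, hM.prop.2⟩
  · exact M.prop_of_retract ⟨biprod.inl, biprod.fst, by simp⟩ h
  · exact M.prop_of_retract ⟨biprod.inr, biprod.snd, by simp⟩ h
  · refine (key x y h).imp_right fun h₁ => ?_
    exact (key y a (M.prop_of_iso (β_ a y) h₁)).resolve_right
      fun h₂ => hM.prop.2 (hMt.of_tensor_self h₂)

/-- There are no nonzero morphisms between objects with disjoint supports. -/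
lemma hom_eq_zero_of_disjoint [StronglyClosed K] {Y Z : Set (Spc K)} (hYZ : Disjoint Y Z)
    {a b : K} (ha : supportedOn Y a) (hb : supportedOn Z b) (f : a ⟶ b) : f = 0 := by
  refine hom_eq_zero_of_isZero_tensor (fun d => ?_) f
  by_contra hn
  obtain ⟨P, -, hP⟩ := exists_prime_of_not_mem isThickIdeal_isZero hn
  rw [supportedOn_iff] at ha hb
  by_cases hPY : P ∈ Y
  · have h₁ := P.ideal b (a ⊗ d) (hb P (Set.disjoint_left.1 hYZ hPY))
    exact hP (P.carrier.prop_of_iso (β_ b (a ⊗ d) ≪≫ α_ a d b) h₁)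
  · exact hP (P.ideal _ _ (ha P hPY))

end ThickIdeals

/-! ### Quasi-compact open subsets of the spectrum -/

section Topology

variable {K : Type u} [Category.{v} K] [HasZeroObject K] [HasShift K ℤ] [Preadditive K]
  [∀ n : ℤ, (shiftFunctor K n).Additive] [Pretriangulated K] [MonoidalCategory K]

lemma supp_biprod (a b : K) : supp (a ⊞ b) = supp a ∪ supp b := by
  ext P
  simp only [supp, Set.mem_ofPred_eq, Set.mem_union, ← not_and_or, not_iff_not]
  exact ⟨P.thick a b, fun h => P.carrier.ext_of_isTriangulatedClosed₂ _
    (binaryBiproductTriangle_distinguished a b) h.1 h.2⟩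

lemma supp_unit : supp (𝟙_ K) = Set.univ := by
  refine Set.eq_univ_of_forall fun P hP => ?_
  obtain ⟨a, ha⟩ := P.proper
  exact ha (P.carrier.prop_of_iso (λ_ a) (P.ideal _ a hP))

lemma supp_zero : supp (0 : K) = ∅ :=
  Set.eq_empty_of_forall_notMem fun P hP => hP P.carrier.prop_zero

variable [SymmetricCategory K]

lemma supp_tensor (a b : K) : supp (a ⊗ b) = supp a ∩ supp b := by
  ext P
  simp only [supp, Set.mem_ofPred_eq, Set.mem_inter_iff, ← not_or, not_iff_not]
  exact ⟨P.prime a b, fun h => h.elim (P.ideal a b)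
    fun h => P.carrier.prop_of_iso (β_ b a) (P.ideal b a h)⟩

/-- The quasi-compact open subsets of the spectrum are the complements of supports. -/
lemma exists_supp_eq_compl {U : Set (Spc K)} (hU : IsOpen U) (hU' : IsCompact U) :
    ∃ a : K, supp a = Uᶜ := by
  have hb : TopologicalSpace.IsTopologicalBasis (Set.range fun a : K => (supp a)ᶜ) := by
    have h := TopologicalSpace.isTopologicalBasis_of_subbasis_of_inter
      (r := Set.range fun a : K => (supp a)ᶜ) (t := (inferInstance : TopologicalSpace (Spc K))) (by
        refine congrArg _ (congrArg _ (funext fun a => ?_))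
        simp [supp, Set.compl_def]) (by
        rintro _ ⟨a, rfl⟩ _ ⟨b, rfl⟩
        exact ⟨a ⊞ b, by simp [supp_biprod, Set.compl_union]⟩)
    rwa [Set.insert_eq_of_mem (Set.mem_range.2 ⟨(0 : K), by simp [supp_zero]⟩)] at h
  obtain ⟨s, hs, rfl⟩ := eq_finite_iUnion_of_isTopologicalBasis_of_isCompact_open _ hb U hU' hU
  clear hU hU'
  induction s, hs using Set.Finite.induction_on with
  | empty => exact ⟨𝟙_ K, by simp [supp_unit]⟩
  | @insert b s _ _ ih =>
    obtain ⟨a, ha⟩ := ih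
    exact ⟨b ⊗ a, by rw [supp_tensor, ha]; simp⟩

end Topology

/-! ### Objects supported on a disjoint union -/

section Decomposition

variable {K : Type u} [Category.{v} K] [HasZeroObject K] [HasShift K ℤ] [Preadditive K]
  [∀ n : ℤ, (shiftFunctor K n).Additive] [Pretriangulated K]

lemma triangle_distinguished_of_iso {x y y' z z' : K} {f : x ⟶ y} {g : y ⟶ z}
    {h : z ⟶ x⟦(1 : ℤ)⟧} (hT : Triangle.mk f g h ∈ distTriang K) (e₂ : y ≅ y') (e₃ : z ≅ z')
    {f' : x ⟶ y'} (hf : f' = f ≫ e₂.hom) {g' : y' ⟶ z'} (hg : e₂.hom ≫ g' = g ≫ e₃.hom)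
    {h' : z' ⟶ x⟦(1 : ℤ)⟧} (hh : e₃.hom ≫ h' = h) :
    Triangle.mk f' g' h' ∈ distTriang K :=
  isomorphic_distinguished _ hT _ (Iso.symm (Triangle.isoMk (Triangle.mk f g h)
    (Triangle.mk f' g' h') (Iso.refl x) e₂ e₃ ((id_comp f').trans hf).symm hg.symm
    ((congrArg (h ≫ ·) (CategoryTheory.Functor.map_id _ _)).trans ((comp_id h).trans hh.symm))))

/-- If there are no nonzero morphisms from `Q` to `P`, then extensions of `P` by `Q` split. -/
lemma exists_iso_biprod_of_extensionProduct {P Q : ObjectProperty K}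
    [P.IsStableUnderShift ℤ] (h : ∀ ⦃x y : K⦄, Q x → P y → ∀ f : x ⟶ y, f = 0) {c : K}
    (hc : P.extensionProduct Q c) : ∃ x y : K, P x ∧ Q y ∧ Nonempty (c ≅ x ⊞ y) := by
  obtain ⟨x, y, f, g, k, hT, hx, hy⟩ := hc
  obtain ⟨e, -⟩ := exists_iso_binaryBiproduct_of_distTriang _ hT (h hy (P.le_shift 1 _ hx) k)
  exact ⟨x, y, hx, hy, ⟨e⟩⟩

/-- In an idempotent complete category, a direct summand of `x ⊞ y` is a sum of summands of `x`
and `y` if `Hom(x, y) = 0 = Hom(y, x)`: the two components of its identity are orthogonal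
idempotents. -/
lemma exists_iso_biprod_of_retract [IsIdempotentComplete K] {c x y : K} (r : Retract c (x ⊞ y))
    (hxy : ∀ f : x ⟶ y, f = 0) (hyx : ∀ f : y ⟶ x, f = 0) :
    ∃ c₁ c₂ : K, Nonempty (Retract c₁ x) ∧ Nonempty (Retract c₂ y) ∧ Nonempty (c ≅ c₁ ⊞ c₂) := by
  -- a decomposition of the identity of `c` through `x` and `y`; its terms are idempotent by
  -- orthogonality
  obtain ⟨u₁, v₁, u₂, v₂, h⟩ : ∃ (u₁ : c ⟶ x) (v₁ : x ⟶ c) (u₂ : c ⟶ y) (v₂ : y ⟶ c),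
      u₁ ≫ v₁ + u₂ ≫ v₂ = 𝟙 c := by
    refine ⟨r.i ≫ biprod.fst, biprod.inl ≫ r.r, r.i ≫ biprod.snd, biprod.inr ≫ r.r, ?_⟩
    calc _ = r.i ≫ (biprod.fst ≫ biprod.inl + biprod.snd ≫ biprod.inr) ≫ r.r := by
          simp [-biprod.total]
      _ = 𝟙 c := by simp
  have h₁₂ : v₁ ≫ u₂ = 0 := hxy _
  have h₂₁ : v₂ ≫ u₁ = 0 := hyx _
  have e₁ : u₁ ≫ v₁ ≫ u₁ = u₁ := by
    have := h =≫ u₁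
    simpa [h₂₁] using this
  have e₂ : u₂ ≫ v₂ ≫ u₂ = u₂ := by
    have := h =≫ u₂
    simpa [h₁₂] using this
  obtain ⟨c₁, i₁, p₁, hc₁, hp₁⟩ := IsIdempotentComplete.idempotents_split c (u₁ ≫ v₁)
    (by simp [reassoc_of% e₁])
  obtain ⟨c₂, i₂, p₂, hc₂, hp₂⟩ := IsIdempotentComplete.idempotents_split c (u₂ ≫ v₂)
    (by simp [reassoc_of% e₂])
  have f₁ : i₁ = i₁ ≫ u₁ ≫ v₁ := by rw [← hp₁, reassoc_of% hc₁]
  have f₂ : i₂ = i₂ ≫ u₂ ≫ v₂ := by rw [← hp₂, reassoc_of% hc₂]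
  have g₁ : p₁ = (u₁ ≫ v₁) ≫ p₁ := by rw [← hp₁, assoc, hc₁, comp_id]
  have g₂ : p₂ = (u₂ ≫ v₂) ≫ p₂ := by rw [← hp₂, assoc, hc₂, comp_id]
  have k₁₂ : i₁ ≫ p₂ = 0 := by rw [f₁, g₂]; simp [reassoc_of% h₁₂]
  have k₂₁ : i₂ ≫ p₁ = 0 := by rw [f₂, g₁]; simp [reassoc_of% h₂₁]
  refine ⟨c₁, c₂, ⟨⟨i₁ ≫ u₁, v₁ ≫ p₁, ?_⟩⟩, ⟨⟨i₂ ≫ u₂, v₂ ≫ p₂, ?_⟩⟩,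
    ⟨⟨biprod.lift p₁ p₂, biprod.desc i₁ i₂, ?_, ?_⟩⟩⟩
  · rw [assoc, ← assoc u₁, ← g₁, hc₁]
  · rw [assoc, ← assoc u₂, ← g₂, hc₂]
  · rw [biprod.lift_desc, hp₁, hp₂, h]
  · ext <;> simp [hc₁, hc₂, k₁₂, k₂₁]

variable [IsTriangulated K]

/-- The extensions of `P` by `Q` are closed under extensions if `P` and `Q` are and if every
extension of `Q` by `P` splits. -/
lemma extensionProduct_extensionProduct_le {P Q : ObjectProperty K}
    [P.IsTriangulated] [Q.IsTriangulated] [P.IsClosedUnderIsomorphisms]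
    [Q.IsClosedUnderIsomorphisms] (h : ∀ ⦃x y : K⦄, P x → Q y → ∀ f : x ⟶ y, f = 0) :
    (P.extensionProduct Q).extensionProduct (P.extensionProduct Q) ≤ P.extensionProduct Q := by
  have hQP : Q.extensionProduct P ≤ P.extensionProduct Q := by
    intro c hc
    obtain ⟨x, y, hx, hy, ⟨e⟩⟩ := exists_iso_biprod_of_extensionProduct h hc
    exact ⟨y, x, _, _, _, triangle_distinguished_of_iso
      (binaryBiproductTriangle_distinguished y x) (e ≪≫ biprod.braiding x y).symm (Iso.refl x)
      rfl (g' := e.hom ≫ biprod.fst) (by simp) (h' := 0) (by simp), hy, hx⟩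
  rw [ObjectProperty.extensionProduct_assoc, ← ObjectProperty.extensionProduct_assoc Q P Q]
  refine (ObjectProperty.monotone_extensionProduct_right _
    (ObjectProperty.monotone_extensionProduct_left _ hQP)).trans ?_
  rw [ObjectProperty.extensionProduct_assoc, ← ObjectProperty.extensionProduct_assoc P P]
  exact (ObjectProperty.monotone_extensionProduct_left _
    (ObjectProperty.extensionProduct_le_of_isTriangulatedClosed₂ le_rfl le_rfl)).trans
    (ObjectProperty.monotone_extensionProduct_right _
      (ObjectProperty.extensionProduct_le_of_isTriangulatedClosed₂ le_rfl le_rfl))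

variable [MonoidalCategory K] [SymmetricCategory K] [TensorTriangulated K] [StronglyClosed K]

/-- The direct summands of the extensions of `K_Y` by `K_Z` form a thick ideal if `Y` and `Z` are
disjoint. -/
lemma isThickIdeal_extensionProduct {Y Z : Set (Spc K)} (hYZ : Disjoint Y Z) :
    IsThickIdeal ((supportedOn Y).extensionProduct (supportedOn Z)).retractClosure where
  isTriangulated :=
    { exists_zero := ⟨0, isZero_zero K, ObjectProperty.le_retractClosure _ _
        (ObjectProperty.le_extensionProduct_left _ _ (ObjectProperty.prop_zero _))⟩
      isStableUnderShiftBy := fun n => ⟨by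
        rintro x ⟨y, hy, ⟨r⟩⟩
        exact ⟨y⟦n⟧, ObjectProperty.le_shift _ n _ hy, ⟨r.map (shiftFunctor K n)⟩⟩⟩
      ext₂' := fun T hT h₁ h₃ => ObjectProperty.le_isoClosure _ _
        (ObjectProperty.monotone_retractClosure
          (extensionProduct_extensionProduct_le fun _ _ ha hb => hom_eq_zero_of_disjoint hYZ ha hb)
          _ (ObjectProperty.extensionProduct_retractClosure_retractClosure_le _ _ _
            ⟨_, _, _, _, _, hT, h₁, h₃⟩)) }
  isStableUnderRetracts := inferInstance
  tensor a b := by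
    rintro ⟨y, ⟨y₁, y₂, f, g, h, hT, h₁, h₂⟩, ⟨r⟩⟩
    exact ⟨y ⊗ b, ⟨_, _, _, _, _, ((curriedTensor K).flip.obj b).map_distinguished _ hT,
      supportedOn_tensor b h₁, supportedOn_tensor b h₂⟩, ⟨r.map ((curriedTensor K).flip.obj b)⟩⟩

/-- An object supported on a disjoint union of two supports is the direct sum of objects with
support in each of them. -/
lemma exists_iso_biprod_of_supportedOn_union [IsIdempotentComplete K] {a₁ a₂ c : K}
    (hd : Disjoint (supp a₁) (supp a₂)) (hc : supportedOn (supp a₁ ∪ supp a₂) c) :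
    ∃ c₁ c₂ : K, supportedOn (supp a₁) c₁ ∧ supportedOn (supp a₂) c₂ ∧
      Nonempty (c ≅ c₁ ⊞ c₂) := by
  have hJ := isThickIdeal_extensionProduct hd
  have hcJ : ((supportedOn (supp a₁)).extensionProduct
      (supportedOn (supp a₂))).retractClosure c := by
    by_contra hn
    obtain ⟨P, hJP, hP⟩ := exists_prime_of_not_mem hJ hn
    rcases hc hP with h | h
    · exact h (hJP _ (ObjectProperty.le_retractClosure _ _
        (ObjectProperty.le_extensionProduct_left _ _ subset_rfl)))
    · exact h (hJP _ (ObjectProperty.le_retractClosure _ _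
        (ObjectProperty.le_extensionProduct_right _ _ subset_rfl)))
  obtain ⟨y, hy, ⟨r⟩⟩ := hcJ
  obtain ⟨y₁, y₂, h₁, h₂, ⟨e⟩⟩ := exists_iso_biprod_of_extensionProduct
    (fun _ _ ha hb => hom_eq_zero_of_disjoint hd.symm ha hb) hy
  obtain ⟨c₁, c₂, ⟨r₁⟩, ⟨r₂⟩, he⟩ := exists_iso_biprod_of_retract (r.trans (Retract.ofIso e))
    (hom_eq_zero_of_disjoint hd h₁ h₂) (hom_eq_zero_of_disjoint hd.symm h₂ h₁)
  exact ⟨c₁, c₂, ObjectProperty.prop_of_retract _ r₁ h₁, ObjectProperty.prop_of_retract _ r₂ h₂, he⟩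

/-- The cone of a `U₁ ∩ U₂`-isomorphism is supported on the disjoint union of the complements of
`U₁` and `U₂`, and splits accordingly. -/
lemma nonempty_coneSplitting [IsIdempotentComplete K] {U₁ U₂ : Set (Spc K)}
    (hU₁ : IsOpen U₁) (hU₁' : IsCompact U₁) (hU₂ : IsOpen U₂) (hU₂' : IsCompact U₂)
    (hcover : U₁ ∪ U₂ = Set.univ) {x a : K} {s : x ⟶ a} (hs : uIso (U₁ ∩ U₂) s) :
    Nonempty (ConeSplitting U₁ U₂ s) := by
  obtain ⟨c, g, h, hT, hc⟩ := hs
  obtain ⟨a₁, ha₁⟩ := exists_supp_eq_compl hU₁ hU₁'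
  obtain ⟨a₂, ha₂⟩ := exists_supp_eq_compl hU₂ hU₂'
  have hd : Disjoint (supp a₁) (supp a₂) := by
    rw [ha₁, ha₂, Set.disjoint_compl_left_iff_subset]
    exact Set.compl_subset_iff_union.2 (Set.union_comm U₁ U₂ ▸ hcover)
  rw [Set.compl_inter, ← ha₁, ← ha₂] at hc
  obtain ⟨c₁, c₂, h₁, h₂, ⟨e⟩⟩ := exists_iso_biprod_of_supportedOn_union hd hc
  exact ⟨⟨c₁, c₂, ha₁ ▸ h₁, ha₂ ▸ h₂, g ≫ e.hom ≫ biprod.fst, g ≫ e.hom ≫ biprod.snd,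
    biprod.inl ≫ e.inv ≫ h, biprod.inr ≫ e.inv ≫ h,
    triangle_distinguished_of_iso hT (Iso.refl a) e (by simp) (by ext <;> simp)
      (by rw [← cancel_epi e.inv]; ext <;> simp)⟩⟩

end Decomposition

/-! ### Exactness of `Hom(-, b)` on a distinguished triangle -/

section Triangles

variable {K : Type u} [Category.{v} K] [HasZeroObject K] [HasShift K ℤ] [Preadditive K]
  [∀ n : ℤ, (shiftFunctor K n).Additive] [Pretriangulated K]

variable {x y z b : K} {f : x ⟶ y} {g : y ⟶ z} {h : z ⟶ x⟦(1 : ℤ)⟧}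

lemma exists_eq_comp_of_comp_shift_eq_zero (hT : Triangle.mk f g h ∈ distTriang K) (k : x ⟶ b)
    (hk : h ≫ k⟦(1 : ℤ)⟧' = 0) : ∃ l : y ⟶ b, k = f ≫ l := by
  obtain ⟨l, hl⟩ : ∃ l : y⟦(1 : ℤ)⟧ ⟶ b⟦(1 : ℤ)⟧, k⟦(1 : ℤ)⟧' = (-f⟦(1 : ℤ)⟧') ≫ l :=
    Triangle.yoneda_exact₂ _ (rot_of_distTriang _ (rot_of_distTriang _ hT)) (k⟦(1 : ℤ)⟧') hk
  obtain ⟨l, rfl⟩ := (shiftFunctor K (1 : ℤ)).map_surjective l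
  exact ⟨-l, (shiftFunctor K (1 : ℤ)).map_injective (by simp [hl])⟩

lemma exists_shift_eq_comp_of_comp_eq_zero (hT : Triangle.mk f g h ∈ distTriang K)
    (k : z ⟶ b⟦(1 : ℤ)⟧) (hk : g ≫ k = 0) : ∃ l : x ⟶ b, k = h ≫ l⟦(1 : ℤ)⟧' := by
  obtain ⟨l, hl⟩ := Triangle.yoneda_exact₃ _ hT k hk
  obtain ⟨l, rfl⟩ := (shiftFunctor K (1 : ℤ)).map_surjective l
  exact ⟨l, hl⟩

end Triangles

section MayerVietoris

variable {K : Type u} [Category.{v} K] [HasZeroObject K] [HasShift K ℤ] [Preadditive K]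
  [∀ n : ℤ, (shiftFunctor K n).Additive] [Pretriangulated K] [MonoidalCategory K]

/-! ### Splittings of the cone -/

namespace ConeSplitting

variable {U₁ U₂ : Set (Spc K)} {x a b : K} {s : x ⟶ a} (σ : ConeSplitting U₁ U₂ s)

/-- The splitting with the two summands exchanged. -/
noncomputable def swap : ConeSplitting U₂ U₁ s where
  c₁ := σ.c₂
  c₂ := σ.c₁
  supp₁ := σ.supp₂
  supp₂ := σ.supp₁
  α := σ.β
  β := σ.α
  γ := σ.δ
  δ := σ.γ
  distinguished := triangle_distinguished_of_iso σ.distinguished (Iso.refl a)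
    (biprod.braiding σ.c₁ σ.c₂) (by simp) (by ext <;> simp) (by ext <;> simp)

/-- The splitting, with one summand zero, of the cone of a `U₁`-isomorphism. -/
noncomputable def ofTriangle {c : K} {α : a ⟶ c} {γ : c ⟶ x⟦(1 : ℤ)⟧}
    (hT : Triangle.mk s α γ ∈ distTriang K) (hc : supportedOn U₁ᶜ c) : ConeSplitting U₁ U₂ s where
  c₁ := c
  c₂ := 0
  supp₁ := hc
  supp₂ := ObjectProperty.prop_zero _
  α := α
  β := 0
  γ := γ
  δ := 0
  distinguished := triangle_distinguished_of_iso hT (Iso.refl a)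
    (isoBiprodZero (isZero_zero K)) (by simp) (by ext; simp) (by simp)

lemma α_γ : σ.α ≫ σ.γ + σ.β ≫ σ.δ = 0 := by
  have : biprod.lift σ.α σ.β ≫ biprod.desc σ.γ σ.δ = 0 :=
    comp_distTriang_mor_zero₂₃ _ σ.distinguished
  simpa using this

lemma α_γ_eq_neg : σ.α ≫ σ.γ = -(σ.β ≫ σ.δ) := eq_neg_of_add_eq_zero_left σ.α_γ

lemma exists_eq_comp_s (f : x ⟶ b) (h₁ : σ.γ ≫ f⟦(1 : ℤ)⟧' = 0) (h₂ : σ.δ ≫ f⟦(1 : ℤ)⟧' = 0) :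
    ∃ l : a ⟶ b, f = s ≫ l :=
  exists_eq_comp_of_comp_shift_eq_zero σ.distinguished f (by ext <;> simp [h₁, h₂])

lemma exists_eq_add (f : a ⟶ b) (h : s ≫ f = 0) :
    ∃ (w₁ : σ.c₁ ⟶ b) (w₂ : σ.c₂ ⟶ b), f = σ.α ≫ w₁ + σ.β ≫ w₂ := by
  obtain ⟨w, hw⟩ : ∃ w, f = biprod.lift σ.α σ.β ≫ w :=
    Triangle.yoneda_exact₂ _ σ.distinguished f h
  refine ⟨biprod.inl ≫ w, biprod.inr ≫ w, ?_⟩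
  rw [hw, ← biprod.lift_desc, biprod.desc_eq]
  congr 1
  ext <;> simp

/-- Compatibility of the connecting morphism with a refinement `t ≫ s` of the denominator `s`:
the morphism between the cones preserves the splittings, as the supports are disjoint. -/
lemma α_γ_comp_shift {x' : K} {t : x' ⟶ x} {s' : x' ⟶ a} (hs : t ≫ s = s')
    (σ' : ConeSplitting U₁ U₂ s')
    (h₁₂ : ∀ ⦃c d : K⦄, supportedOn U₁ᶜ c → supportedOn U₂ᶜ d → ∀ f : c ⟶ d, f = 0)
    (h₂₁ : ∀ ⦃c d : K⦄, supportedOn U₂ᶜ c → supportedOn U₁ᶜ d → ∀ f : c ⟶ d, f = 0) :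
    σ'.α ≫ σ'.γ ≫ t⟦(1 : ℤ)⟧' = σ.α ≫ σ.γ := by
  obtain ⟨h, hh₁, hh₂⟩ : ∃ h : σ'.c₁ ⊞ σ'.c₂ ⟶ σ.c₁ ⊞ σ.c₂,
      biprod.lift σ'.α σ'.β ≫ h = 𝟙 a ≫ biprod.lift σ.α σ.β ∧
      biprod.desc σ'.γ σ'.δ ≫ t⟦(1 : ℤ)⟧' = h ≫ biprod.desc σ.γ σ.δ :=
    complete_distinguished_triangle_morphism _ _ σ'.distinguished σ.distinguished t (𝟙 a)
      (show s' ≫ 𝟙 a = t ≫ s by rw [comp_id, hs])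
  have hα : σ'.α ≫ biprod.inl ≫ h ≫ biprod.fst = σ.α := by
    have h₀ := h₂₁ σ'.supp₂ σ.supp₁ (biprod.inr ≫ h ≫ biprod.fst)
    simpa [biprod.lift_eq, h₀] using hh₁ =≫ biprod.fst
  have hγ : σ'.γ ≫ t⟦(1 : ℤ)⟧' = (biprod.inl ≫ h ≫ biprod.fst) ≫ σ.γ := by
    have h₀ := h₁₂ σ'.supp₁ σ.supp₂ (biprod.inl ≫ h ≫ biprod.snd)
    have h₃ : σ'.γ ≫ t⟦(1 : ℤ)⟧' = biprod.inl ≫ h ≫ biprod.desc σ.γ σ.δ := by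
      simpa using biprod.inl ≫= hh₂
    rw [h₃, biprod.desc_eq]
    simp [reassoc_of% h₀]
  rw [hγ, ← hα]
  simp only [assoc]

section Fibers

variable {x₁ x₂ : K} {s₁ : x₁ ⟶ a} {γ₁ : σ.c₁ ⟶ x₁⟦(1 : ℤ)⟧} {s₂ : x₂ ⟶ a}
  {γ₂ : σ.c₂ ⟶ x₂⟦(1 : ℤ)⟧}

/-- The denominator `s` factors through the fiber `s₁ : x₁ ⟶ a` of `α`. -/
lemma exists_hom_fiber (hT₁ : Triangle.mk s₁ σ.α γ₁ ∈ distTriang K) :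
    ∃ t₁ : x ⟶ x₁, t₁ ≫ s₁ = s ∧ σ.γ ≫ t₁⟦(1 : ℤ)⟧' = γ₁ ∧ σ.δ ≫ t₁⟦(1 : ℤ)⟧' = 0 := by
  obtain ⟨t, ht₁, ht₂⟩ : ∃ t : x ⟶ x₁, s ≫ 𝟙 a = t ≫ s₁ ∧
      biprod.desc σ.γ σ.δ ≫ t⟦(1 : ℤ)⟧' = biprod.fst ≫ γ₁ :=
    complete_distinguished_triangle_morphism₁ _ _ σ.distinguished hT₁ (𝟙 a) biprod.fst
      (show biprod.lift σ.α σ.β ≫ biprod.fst = 𝟙 a ≫ σ.α by simp)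
  refine ⟨t, by simpa using ht₁.symm, ?_, ?_⟩
  · simpa using biprod.inl ≫= ht₂
  · simpa using biprod.inr ≫= ht₂

variable {t₁ : x ⟶ x₁} {t₂ : x ⟶ x₂}

/-- If the connecting morphism of `f s⁻¹` vanishes, then `f` is a sum of morphisms that extend to
the fibers of `α` and of `β`. -/
lemma exists_eq_comp_fiber_add (hT₁ : Triangle.mk s₁ σ.α γ₁ ∈ distTriang K)
    (hT₂ : Triangle.mk s₂ σ.β γ₂ ∈ distTriang K)
    (ht₁ : t₁ ≫ s₁ = s) (hγ₁ : σ.γ ≫ t₁⟦(1 : ℤ)⟧' = γ₁) (hδ₁ : σ.δ ≫ t₁⟦(1 : ℤ)⟧' = 0)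
    (hγ₂ : σ.γ ≫ t₂⟦(1 : ℤ)⟧' = 0) (hδ₂ : σ.δ ≫ t₂⟦(1 : ℤ)⟧' = γ₂)
    (f : x ⟶ b) (hf : σ.α ≫ σ.γ ≫ f⟦(1 : ℤ)⟧' = 0) :
    ∃ (f₁ : x₁ ⟶ b) (f₂ : x₂ ⟶ b), f = t₁ ≫ f₁ + t₂ ≫ f₂ ∧
      γ₂ ≫ f₂⟦(1 : ℤ)⟧' = σ.δ ≫ f⟦(1 : ℤ)⟧' := by
  have hf' : σ.β ≫ σ.δ ≫ f⟦(1 : ℤ)⟧' = 0 := by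
    have := σ.α_γ =≫ f⟦(1 : ℤ)⟧'
    simpa [hf] using this
  obtain ⟨f₁, h₁⟩ := exists_shift_eq_comp_of_comp_eq_zero hT₁ _ hf
  obtain ⟨f₂, h₂⟩ := exists_shift_eq_comp_of_comp_eq_zero hT₂ _ hf'
  obtain ⟨l, hl⟩ := σ.exists_eq_comp_s (f - t₁ ≫ f₁ - t₂ ≫ f₂)
    (by simp [Functor.map_sub, h₁, reassoc_of% hγ₁, reassoc_of% hγ₂])
    (by simp [Functor.map_sub, h₂, reassoc_of% hδ₁, reassoc_of% hδ₂])
  refine ⟨f₁ + s₁ ≫ l, f₂, ?_, h₂.symm⟩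
  rw [Preadditive.comp_add, reassoc_of% ht₁, ← hl]
  abel

/-- A morphism `f` from `x` with `T f ∘ δ = 0` extends to the fiber of `α`. -/
lemma exists_eq_comp_fiber (hT₁ : Triangle.mk s₁ σ.α γ₁ ∈ distTriang K)
    (hT₂ : Triangle.mk s₂ σ.β γ₂ ∈ distTriang K)
    (ht₁ : t₁ ≫ s₁ = s) (hγ₁ : σ.γ ≫ t₁⟦(1 : ℤ)⟧' = γ₁) (hδ₁ : σ.δ ≫ t₁⟦(1 : ℤ)⟧' = 0)
    (ht₂ : t₂ ≫ s₂ = s) (hγ₂ : σ.γ ≫ t₂⟦(1 : ℤ)⟧' = 0) (hδ₂ : σ.δ ≫ t₂⟦(1 : ℤ)⟧' = γ₂)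
    (f : x ⟶ b) (hf : σ.δ ≫ f⟦(1 : ℤ)⟧' = 0) : ∃ l : x₁ ⟶ b, f = t₁ ≫ l := by
  obtain ⟨f₁, f₂, h, hf₂⟩ := σ.exists_eq_comp_fiber_add hT₁ hT₂ ht₁ hγ₁ hδ₁ hγ₂ hδ₂ f (by
    have := σ.α_γ =≫ f⟦(1 : ℤ)⟧'
    simpa [hf] using this)
  obtain ⟨r, rfl⟩ := exists_eq_comp_of_comp_shift_eq_zero hT₂ f₂ (hf₂.trans hf)
  exact ⟨f₁ + s₁ ≫ r, by rw [h, Preadditive.comp_add, reassoc_of% ht₁, reassoc_of% ht₂]⟩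

lemma exists_eq_of_comp_fiber_eq_zero (hT₁ : Triangle.mk s₁ σ.α γ₁ ∈ distTriang K)
    (ht₁ : t₁ ≫ s₁ = s) (hγ₁ : σ.γ ≫ t₁⟦(1 : ℤ)⟧' = γ₁)
    (k : x₁ ⟶ b) (hk : t₁ ≫ k = 0) : ∃ w : σ.c₂ ⟶ b, k = s₁ ≫ σ.β ≫ w := by
  obtain ⟨l, rfl⟩ := exists_eq_comp_of_comp_shift_eq_zero hT₁ k
    (by rw [← hγ₁, assoc, ← Functor.map_comp, hk, Functor.map_zero, comp_zero])
  obtain ⟨w₁, w₂, rfl⟩ := σ.exists_eq_add l (by rw [← ht₁, assoc, hk])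
  have h₀ : s₁ ≫ σ.α = 0 := comp_distTriang_mor_zero₁₂ _ hT₁
  exact ⟨w₂, by simp [reassoc_of% h₀]⟩

/-- Two morphisms on the fibers of `α` and `β` that agree on `x` come from `a` up to morphisms
that factor through `c₂` and `c₁` respectively; these can be corrected independently. -/
lemma exists_common_extension (hT₁ : Triangle.mk s₁ σ.α γ₁ ∈ distTriang K)
    (hT₂ : Triangle.mk s₂ σ.β γ₂ ∈ distTriang K)
    (ht₁ : t₁ ≫ s₁ = s) (hγ₁ : σ.γ ≫ t₁⟦(1 : ℤ)⟧' = γ₁) (hδ₁ : σ.δ ≫ t₁⟦(1 : ℤ)⟧' = 0)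
    (ht₂ : t₂ ≫ s₂ = s) (hγ₂ : σ.γ ≫ t₂⟦(1 : ℤ)⟧' = 0) (hδ₂ : σ.δ ≫ t₂⟦(1 : ℤ)⟧' = γ₂)
    (f₁ : x₁ ⟶ b) (f₂ : x₂ ⟶ b) (hf : t₁ ≫ f₁ = t₂ ≫ f₂) :
    ∃ l : a ⟶ b, s₁ ≫ l = f₁ ∧ s₂ ≫ l = f₂ := by
  obtain ⟨l, hl⟩ := σ.exists_eq_comp_s (t₁ ≫ f₁)
    (by rw [hf, Functor.map_comp, reassoc_of% hγ₂, zero_comp])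
    (by rw [Functor.map_comp, reassoc_of% hδ₁, zero_comp])
  obtain ⟨w₂, hw₂⟩ := σ.exists_eq_of_comp_fiber_eq_zero hT₁ ht₁ hγ₁ (f₁ - s₁ ≫ l)
    (by rw [Preadditive.comp_sub, reassoc_of% ht₁, hl, sub_self])
  obtain ⟨w₁, hw₁⟩ := σ.swap.exists_eq_of_comp_fiber_eq_zero hT₂ ht₂ hδ₂ (f₂ - s₂ ≫ l)
    (by rw [Preadditive.comp_sub, reassoc_of% ht₂, ← hf, hl, sub_self])
  change σ.c₁ ⟶ b at w₁
  change f₂ - s₂ ≫ l = s₂ ≫ σ.α ≫ w₁ at hw₁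
  have h₁ : s₁ ≫ σ.α = 0 := comp_distTriang_mor_zero₁₂ _ hT₁
  have h₂ : s₂ ≫ σ.β = 0 := comp_distTriang_mor_zero₁₂ _ hT₂
  refine ⟨l + σ.α ≫ w₁ + σ.β ≫ w₂, ?_, ?_⟩
  · simp only [Preadditive.comp_add, reassoc_of% h₁, zero_comp, ← hw₂]
    abel
  · simp only [Preadditive.comp_add, reassoc_of% h₂, zero_comp, ← hw₁]
    abel

end Fibers

end ConeSplitting

end MayerVietoris

/-! ### The inverse of the translation on morphisms -/

section Unshift

variable {K : Type u} [Category.{v} K] [HasShift K ℤ] [Preadditive K]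
  [∀ n : ℤ, (shiftFunctor K n).Additive] {a b : K}

lemma shift_unshiftHom (f : a⟦(1 : ℤ)⟧ ⟶ b⟦(1 : ℤ)⟧) : (unshiftHom a b f)⟦(1 : ℤ)⟧' = f :=
  (shiftFunctor K (1 : ℤ)).map_preimage f

lemma unshiftHom_shift (f : a ⟶ b) : unshiftHom a b (f⟦(1 : ℤ)⟧') = f :=
  (shiftFunctor K (1 : ℤ)).preimage_map f

end Unshift

section MayerVietoris

variable {K : Type u} [Category.{v} K] [HasZeroObject K] [HasShift K ℤ] [Preadditive K]
  [∀ n : ℤ, (shiftFunctor K n).Additive] [Pretriangulated K] [MonoidalCategory K]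

/-! ### Morphisms in the Verdier quotients -/

variable {U V : Set (Spc K)} {a b x : K}

lemma rhoLoc_map_rho_map (h : U ⊆ V) (f : a ⟶ b) :
    (rhoLoc h).map ((rho V).map f) = (rho U).map f := rfl

lemma fracMor_eq_iff (φ : (uIso U).RightFraction a b) (m : Mor U a b) :
    fracMor φ = m ↔ (rho U).map φ.f = (rho U).map φ.s ≫ m := by
  have := Localization.inverts (rho U) (uIso U) _ φ.hs
  rw [← cancel_epi ((rho U).map φ.s), fracMor, MorphismProperty.RightFraction.map_s_comp_map]

variable [IsTriangulated K]

lemma exists_fracMor_eq (m : Mor U a b) : ∃ φ : (uIso U).RightFraction a b, fracMor φ = m := by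
  obtain ⟨φ, hφ⟩ := Localization.exists_rightFraction (rho U) (uIso U) m
  exact ⟨φ, hφ.symm⟩

/-- Two morphisms in the Verdier quotient have a common denominator. -/
lemma exists_common_denominator (m n : Mor U a b) :
    ∃ (x : K) (s : x ⟶ a) (hs : uIso U s) (f g : x ⟶ b),
      fracMor ⟨s, hs, f⟩ = m ∧ fracMor ⟨s, hs, g⟩ = n := by
  obtain ⟨φ, rfl⟩ := exists_fracMor_eq m
  obtain ⟨ψ, rfl⟩ := exists_fracMor_eq n
  obtain ⟨χ, hχ⟩ := (MorphismProperty.LeftFraction.mk φ.s ψ.s ψ.hs).exists_rightFraction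
  have h₁ := (fracMor_eq_iff φ _).1 rfl
  have h₂ := (fracMor_eq_iff ψ _).1 rfl
  refine ⟨_, χ.s ≫ φ.s, (uIso U).comp_mem _ _ χ.hs φ.hs, χ.s ≫ φ.f, χ.f ≫ ψ.f, ?_, ?_⟩
  · rw [fracMor_eq_iff, Functor.map_comp, Functor.map_comp, assoc, h₁]
  · have h₃ : χ.s ≫ φ.s = χ.f ≫ ψ.s := hχ
    rw [fracMor_eq_iff]
    dsimp only
    rw [h₃, Functor.map_comp, Functor.map_comp, assoc, h₂]

lemma rho_map_eq_zero_of_factors {c : K} (hc : supportedOn Uᶜ c) (f : a ⟶ c) (g : c ⟶ b) :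
    (rho U).map (f ≫ g) = 0 := by
  rw [← (rho U).map_zero a b, MorphismProperty.map_eq_iff_precomp (rho U) (uIso U)]
  obtain ⟨y, s, h, hT⟩ := distinguished_cocone_triangle₁ f
  have hs : s ≫ f = 0 := comp_distTriang_mor_zero₁₂ _ hT
  exact ⟨y, s, ⟨_, _, _, hT, hc⟩, by rw [reassoc_of% hs, zero_comp, comp_zero]⟩

/-- A morphism vanishes over `U` if and only if it factors through an object supported outside
`U`. -/
lemma rho_map_eq_zero_iff (f : a ⟶ b) :
    (rho U).map f = 0 ↔ ∃ (c : K) (p : a ⟶ c) (q : c ⟶ b), supportedOn Uᶜ c ∧ f = p ≫ q := by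
  refine ⟨fun h => ?_, ?_⟩
  · rw [← (rho U).map_zero a b, MorphismProperty.map_eq_iff_precomp (rho U) (uIso U)] at h
    obtain ⟨y, s, ⟨c, g, k, hT, hc⟩, hs⟩ := h
    obtain ⟨q, hq⟩ : ∃ q : c ⟶ b, f = g ≫ q :=
      Triangle.yoneda_exact₂ _ hT f (hs.trans comp_zero)
    exact ⟨c, g, q, hc, hq⟩
  · rintro ⟨c, p, q, hc, rfl⟩
    exact rho_map_eq_zero_of_factors hc p q

lemma rho_map_shift_eq_zero_iff (f : a ⟶ b) :
    (rho U).map (f⟦(1 : ℤ)⟧') = 0 ↔ (rho U).map f = 0 := by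
  rw [rho_map_eq_zero_iff, rho_map_eq_zero_iff]
  constructor
  · rintro ⟨c, p, q, hc, hf⟩
    let e : 𝟭 K ≅ shiftFunctor K (1 : ℤ) ⋙ shiftFunctor K (-1 : ℤ) :=
      (shiftEquiv K (1 : ℤ)).unitIso
    have h₁ : f ≫ e.hom.app b = e.hom.app a ≫ (f⟦(1 : ℤ)⟧')⟦(-1 : ℤ)⟧' := e.hom.naturality f
    have h₂ : f = e.hom.app a ≫ (f⟦(1 : ℤ)⟧')⟦(-1 : ℤ)⟧' ≫ e.inv.app b := by
      rw [← reassoc_of% h₁]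
      exact ((f ≫= e.hom_inv_id_app b).trans (comp_id f)).symm
    refine ⟨c⟦(-1 : ℤ)⟧, e.hom.app a ≫ p⟦(-1 : ℤ)⟧', q⟦(-1 : ℤ)⟧' ≫ e.inv.app b,
      ObjectProperty.le_shift _ (-1) _ hc, h₂.trans ?_⟩
    rw [hf, Functor.map_comp, assoc]
    exact (assoc _ _ _).symm
  · rintro ⟨c, p, q, hc, rfl⟩
    exact ⟨c⟦(1 : ℤ)⟧, p⟦(1 : ℤ)⟧', q⟦(1 : ℤ)⟧', ObjectProperty.le_shift _ 1 _ hc,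
      Functor.map_comp _ _ _⟩

lemma resMor_resHom (h : U ⊆ V) (f : a ⟶ b) : resMor h a b (resHom V a b f) = resHom U a b f :=
  rhoLoc_map_rho_map h f

lemma rho_map_comp_resMor (h : U ⊆ V) {s : x ⟶ a} {f : x ⟶ b} {m : Mor V a b}
    (hm : (rho V).map f = (rho V).map s ≫ m) :
    (rho U).map f = (rho U).map s ≫ resMor h a b m := by
  rw [← rhoLoc_map_rho_map h, hm, Functor.map_comp]
  rfl

/-! ### The connecting homomorphism -/

variable {U₁ U₂ : Set (Spc K)}

lemma resDiff_apply (m₁ : Mor U₁ a b) (m₂ : Mor U₂ a b) : resDiff U₁ U₂ a b (m₁, m₂) =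
    resMor Set.inter_subset_left a b m₁ - resMor Set.inter_subset_right a b m₂ := rfl

lemma resPair_eq_zero_iff (f : a ⟶ b) :
    resPair U₁ U₂ a b f = 0 ↔ (rho U₁).map f = 0 ∧ (rho U₂).map f = 0 := Prod.ext_iff

/-- The value on a fraction of the connecting homomorphism does not depend on the choices. -/
lemma conn_eq_of_fracMor_eq
    (hsplit : ∀ ⦃x a : K⦄ (s : x ⟶ a), uIso (U₁ ∩ U₂) s → Nonempty (ConeSplitting U₁ U₂ s))
    (h₁₂ : ∀ ⦃c d : K⦄, supportedOn U₁ᶜ c → supportedOn U₂ᶜ d → ∀ f : c ⟶ d, f = 0)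
    (h₂₁ : ∀ ⦃c d : K⦄, supportedOn U₂ᶜ c → supportedOn U₁ᶜ d → ∀ f : c ⟶ d, f = 0)
    {φ ψ : (uIso (U₁ ∩ U₂)).RightFraction a b} (h : fracMor φ = fracMor ψ)
    (σ : ConeSplitting U₁ U₂ φ.s) (τ : ConeSplitting U₁ U₂ ψ.s) :
    σ.α ≫ σ.γ ≫ φ.f⟦(1 : ℤ)⟧' = τ.α ≫ τ.γ ≫ ψ.f⟦(1 : ℤ)⟧' := by
  obtain ⟨z, t₁, t₂, hs, hf, hz⟩ :=
    (MorphismProperty.RightFraction.map_eq_iff (rho (U₁ ∩ U₂)) (uIso (U₁ ∩ U₂)) φ ψ).1 h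
  obtain ⟨υ⟩ := hsplit _ hz
  have h₁ := σ.α_γ_comp_shift rfl υ h₁₂ h₂₁
  have h₂ := τ.α_γ_comp_shift hs.symm υ h₁₂ h₂₁
  rw [← reassoc_of% h₁, ← reassoc_of% h₂, ← Functor.map_comp, ← Functor.map_comp, hf]

/-- The connecting homomorphisms exist and are unique. -/
lemma existsUnique_isConnecting
    (hsplit : ∀ ⦃x a : K⦄ (s : x ⟶ a), uIso (U₁ ∩ U₂) s → Nonempty (ConeSplitting U₁ U₂ s))
    (h₁₂ : ∀ ⦃c d : K⦄, supportedOn U₁ᶜ c → supportedOn U₂ᶜ d → ∀ f : c ⟶ d, f = 0)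
    (h₂₁ : ∀ ⦃c d : K⦄, supportedOn U₂ᶜ c → supportedOn U₁ᶜ d → ∀ f : c ⟶ d, f = 0) :
    ∃! del : ∀ a b : K, Mor (U₁ ∩ U₂) a b →+ (a ⟶ b⟦(1 : ℤ)⟧), IsConnecting U₁ U₂ del := by
  choose φ hφ using fun (a b : K) (m : Mor (U₁ ∩ U₂) a b) => exists_fracMor_eq m
  let σ (a b : K) (m : Mor (U₁ ∩ U₂) a b) : ConeSplitting U₁ U₂ (φ a b m).s :=
    (hsplit _ (φ a b m).hs).some
  let d (a b : K) (m : Mor (U₁ ∩ U₂) a b) : a ⟶ b⟦(1 : ℤ)⟧ :=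
    (σ a b m).α ≫ (σ a b m).γ ≫ (φ a b m).f⟦(1 : ℤ)⟧'
  have hd {a b : K} (ψ : (uIso (U₁ ∩ U₂)).RightFraction a b) (τ : ConeSplitting U₁ U₂ ψ.s) :
      d a b (fracMor ψ) = τ.α ≫ τ.γ ≫ ψ.f⟦(1 : ℤ)⟧' :=
    conn_eq_of_fracMor_eq hsplit h₁₂ h₂₁ (hφ a b (fracMor ψ)) _ τ
  have hadd (a b : K) (m n : Mor (U₁ ∩ U₂) a b) : d a b (m + n) = d a b m + d a b n := by
    obtain ⟨x, s, hs, f, g, rfl, rfl⟩ := exists_common_denominator m n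
    obtain ⟨τ⟩ := hsplit s hs
    have h₁ := (fracMor_eq_iff ⟨s, hs, f⟩ _).1 rfl
    have h₂ := (fracMor_eq_iff ⟨s, hs, g⟩ _).1 rfl
    have h₃ : fracMor ⟨s, hs, f + g⟩ = fracMor ⟨s, hs, f⟩ + fracMor ⟨s, hs, g⟩ := by
      rw [fracMor_eq_iff, Functor.map_add, Preadditive.comp_add, ← h₁, ← h₂]
    rw [← h₃, hd _ τ, hd _ τ, hd _ τ]
    simp [Functor.map_add]
  refine ⟨fun a b => AddMonoidHom.mk' (d a b) (hadd a b), fun a b ψ τ => ⟨hd ψ τ, ?_⟩, ?_⟩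
  · refine (hd ψ τ).trans ?_
    have := τ.α_γ_eq_neg =≫ ψ.f⟦(1 : ℤ)⟧'
    simpa using this
  · intro del hdel
    ext a b m
    have h := (hdel a b (φ a b m) (σ a b m)).1
    rwa [hφ] at h

/-! ### Exactness of the Mayer-Vietoris sequence -/

/-- Exactness at `Mor_{U₁}(a, b) ⊕ Mor_{U₂}(a, b)`: after the numerators are changed by morphisms
that vanish over `U₁` and over `U₂` respectively, they agree on the fiber `x` of
`a ⟶ c₁ ⊞ c₂`, and hence come from a morphism on `a`. -/
lemma exact_resPair_resDiff
    (hsplit : ∀ ⦃x a : K⦄ (s : x ⟶ a), uIso (U₁ ∩ U₂) s → Nonempty (ConeSplitting U₁ U₂ s))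
    (h₁₂ : ∀ ⦃c d : K⦄, supportedOn U₁ᶜ c → supportedOn U₂ᶜ d → ∀ f : c ⟶ d, f = 0)
    (h₂₁ : ∀ ⦃c d : K⦄, supportedOn U₂ᶜ c → supportedOn U₁ᶜ d → ∀ f : c ⟶ d, f = 0) (a b : K) :
    Function.Exact (resPair U₁ U₂ a b) (resDiff U₁ U₂ a b) := by
  rintro ⟨m₁, m₂⟩
  constructor
  · intro h
    rw [resDiff_apply, sub_eq_zero] at h
    obtain ⟨⟨s₁, hs₁, f₁⟩, rfl⟩ := exists_fracMor_eq m₁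
    obtain ⟨⟨s₂, hs₂, f₂⟩, rfl⟩ := exists_fracMor_eq m₂
    have hm₁ := (fracMor_eq_iff ⟨s₁, hs₁, f₁⟩ _).1 rfl
    have hm₂ := (fracMor_eq_iff ⟨s₂, hs₂, f₂⟩ _).1 rfl
    obtain ⟨c₁, α, γ₁, hT₁, hc₁⟩ := id hs₁
    obtain ⟨c₂, β, γ₂, hT₂, hc₂⟩ := id hs₂
    obtain ⟨x, s, γδ, hT⟩ := distinguished_cocone_triangle₁ (biprod.lift α β)
    let σ : ConeSplitting U₁ U₂ s := ⟨c₁, c₂, hc₁, hc₂, α, β, biprod.inl ≫ γδ, biprod.inr ≫ γδ,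
      triangle_distinguished_of_iso hT (Iso.refl a) (Iso.refl _) (by simp) (by simp)
        (by ext <;> simp)⟩
    obtain ⟨t₁, ht₁, hγ₁, hδ₁⟩ := σ.exists_hom_fiber hT₁
    obtain ⟨t₂, ht₂, hδ₂, hγ₂⟩ := σ.swap.exists_hom_fiber hT₂
    -- the difference of the numerators on `x` vanishes over `U₁ ∩ U₂`
    have hg : (rho (U₁ ∩ U₂)).map (t₁ ≫ f₁ - t₂ ≫ f₂) = 0 := by
      have k₁ := rho_map_comp_resMor Set.inter_subset_left (U := U₁ ∩ U₂) hm₁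
      have k₂ := rho_map_comp_resMor Set.inter_subset_right (U := U₁ ∩ U₂) hm₂
      dsimp only at k₁ k₂
      rw [Functor.map_sub, Functor.map_comp, Functor.map_comp, k₁, k₂,
        ← Functor.map_comp_assoc, ← Functor.map_comp_assoc, ht₁, ht₂, h, sub_self]
    -- hence it is a sum of morphisms that factor through objects supported outside `Uᵢ`
    rw [← (rho (U₁ ∩ U₂)).map_zero,
      MorphismProperty.map_eq_iff_precomp (rho (U₁ ∩ U₂)) (uIso (U₁ ∩ U₂))] at hg
    obtain ⟨x', s', hs', hg⟩ := hg
    obtain ⟨τ⟩ := hsplit s' hs'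
    obtain ⟨w₁, w₂, hw⟩ := τ.exists_eq_add _ (hg.trans comp_zero)
    -- which extend to the fibers of `α` and `β`, as the supports are disjoint
    obtain ⟨l₁, hl₁⟩ := σ.exists_eq_comp_fiber hT₁ hT₂ ht₁ hγ₁ hδ₁ ht₂ hγ₂ hδ₂ τ.α
      (h₂₁ hc₂ (ObjectProperty.le_shift _ 1 _ τ.supp₁) _)
    obtain ⟨l₂, hl₂⟩ := σ.swap.exists_eq_comp_fiber hT₂ hT₁ ht₂ hδ₂ hγ₂ ht₁ hδ₁ hγ₁ τ.β
      (h₁₂ hc₁ (ObjectProperty.le_shift _ 1 _ τ.supp₂) _)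
    obtain ⟨l, h₁, h₂⟩ := σ.exists_common_extension hT₁ hT₂ ht₁ hγ₁ hδ₁ ht₂ hγ₂ hδ₂
      (f₁ - l₁ ≫ w₁) (f₂ + l₂ ≫ w₂) (by
        rw [Preadditive.comp_sub, Preadditive.comp_add, ← reassoc_of% hl₁, ← reassoc_of% hl₂,
          sub_eq_iff_eq_add, add_assoc, add_comm (τ.β ≫ w₂), ← hw]
        abel)
    refine ⟨l, Prod.ext (Eq.symm ?_) (Eq.symm ?_)⟩
    · rw [fracMor_eq_iff]
      change (rho U₁).map f₁ = (rho U₁).map s₁ ≫ (rho U₁).map l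
      rw [← Functor.map_comp, h₁, Functor.map_sub, rho_map_eq_zero_of_factors τ.supp₁, sub_zero]
    · rw [fracMor_eq_iff]
      change (rho U₂).map f₂ = (rho U₂).map s₂ ≫ (rho U₂).map l
      rw [← Functor.map_comp, h₂, Functor.map_add, rho_map_eq_zero_of_factors τ.supp₂, add_zero]
  · rintro ⟨f, hf⟩
    rw [← hf]
    exact sub_eq_zero.2 ((resMor_resHom Set.inter_subset_left f).trans
      (resMor_resHom Set.inter_subset_right f).symm)

section

variable {del : ∀ a b : K, Mor (U₁ ∩ U₂) a b →+ (a ⟶ b⟦(1 : ℤ)⟧)}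

/-- The connecting homomorphism kills the restrictions of morphisms over `U₁`, as the cone of a
`U₁`-isomorphism has a splitting with `c₂ = 0`. -/
lemma IsConnecting.resMor_left (hdel : IsConnecting U₁ U₂ del) (m : Mor U₁ a b) :
    del a b (resMor Set.inter_subset_left a b m) = 0 := by
  obtain ⟨⟨s, hs, f⟩, rfl⟩ := exists_fracMor_eq m
  obtain ⟨c, α, γ, hT, hc⟩ := id hs
  have h := (hdel a b ⟨s, uIso_mono Set.inter_subset_left s hs, f⟩
    (ConeSplitting.ofTriangle hT hc)).2
  rw [(fracMor_eq_iff _ _).2 (rho_map_comp_resMor Set.inter_subset_left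
    ((fracMor_eq_iff ⟨s, hs, f⟩ _).1 rfl))] at h
  rw [h]
  simp [ConeSplitting.ofTriangle]

lemma IsConnecting.resMor_right (hdel : IsConnecting U₁ U₂ del) (m : Mor U₂ a b) :
    del a b (resMor Set.inter_subset_right a b m) = 0 := by
  obtain ⟨⟨s, hs, f⟩, rfl⟩ := exists_fracMor_eq m
  obtain ⟨c, α, γ, hT, hc⟩ := id hs
  have h := (hdel a b ⟨s, uIso_mono Set.inter_subset_right s hs, f⟩
    (ConeSplitting.ofTriangle hT hc).swap).1
  rw [(fracMor_eq_iff _ _).2 (rho_map_comp_resMor Set.inter_subset_right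
    ((fracMor_eq_iff ⟨s, hs, f⟩ _).1 rfl))] at h
  rw [h]
  simp [ConeSplitting.ofTriangle, ConeSplitting.swap]

/-- Exactness at `Mor_{U₁ ∩ U₂}(a, b)`. -/
lemma IsConnecting.exact_resDiff
    (hsplit : ∀ ⦃x a : K⦄ (s : x ⟶ a), uIso (U₁ ∩ U₂) s → Nonempty (ConeSplitting U₁ U₂ s))
    (hdel : IsConnecting U₁ U₂ del) (a b : K) :
    Function.Exact (resDiff U₁ U₂ a b) (del a b) := by
  intro m
  constructor
  · intro hm
    obtain ⟨⟨s, hs, f⟩, rfl⟩ := exists_fracMor_eq m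
    obtain ⟨σ⟩ := hsplit s hs
    rw [(hdel a b _ σ).1] at hm
    obtain ⟨x₁, s₁, γ₁, hT₁⟩ := distinguished_cocone_triangle₁ σ.α
    obtain ⟨x₂, s₂, γ₂, hT₂⟩ := distinguished_cocone_triangle₁ σ.β
    obtain ⟨t₁, ht₁, hγ₁, hδ₁⟩ := σ.exists_hom_fiber hT₁
    obtain ⟨t₂, ht₂, hδ₂, hγ₂⟩ := σ.swap.exists_hom_fiber hT₂
    obtain ⟨f₁, f₂, hf, -⟩ := σ.exists_eq_comp_fiber_add hT₁ hT₂ ht₁ hγ₁ hδ₁ hγ₂ hδ₂ f hm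
    have hs₁ : uIso U₁ s₁ := ⟨_, _, _, hT₁, σ.supp₁⟩
    have hs₂ : uIso U₂ s₂ := ⟨_, _, _, hT₂, σ.supp₂⟩
    have k₁ := rho_map_comp_resMor Set.inter_subset_left (U := U₁ ∩ U₂)
      ((fracMor_eq_iff ⟨s₁, hs₁, f₁⟩ _).1 rfl)
    have k₂ := rho_map_comp_resMor Set.inter_subset_right (U := U₁ ∩ U₂)
      ((fracMor_eq_iff ⟨s₂, hs₂, f₂⟩ _).1 rfl)
    dsimp only at k₁ k₂
    refine ⟨(fracMor ⟨s₁, hs₁, f₁⟩, -fracMor ⟨s₂, hs₂, f₂⟩), Eq.symm ?_⟩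
    rw [fracMor_eq_iff, resDiff_apply, map_neg, sub_neg_eq_add]
    dsimp only
    rw [Preadditive.comp_add, hf, Functor.map_add, Functor.map_comp, Functor.map_comp, k₁, k₂,
      ← Functor.map_comp_assoc, ← Functor.map_comp_assoc, ht₁, ht₂]
  · rintro ⟨⟨m₁, m₂⟩, rfl⟩
    rw [resDiff_apply, map_sub, hdel.resMor_left, hdel.resMor_right, sub_zero]

/-- Exactness at `Hom(a, T b)`: a morphism that vanishes over `U₁` and over `U₂` factors through
some `c₁` and some `c₂`, and the fiber of `a ⟶ c₁ ⊞ c₂` is the denominator of a preimage. -/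
lemma IsConnecting.exact_resPair
    (hsplit : ∀ ⦃x a : K⦄ (s : x ⟶ a), uIso (U₁ ∩ U₂) s → Nonempty (ConeSplitting U₁ U₂ s))
    (hdel : IsConnecting U₁ U₂ del) (a b : K) :
    Function.Exact (del a b) (resPair U₁ U₂ a (b⟦(1 : ℤ)⟧)) := by
  intro g
  rw [resPair_eq_zero_iff]
  constructor
  · rintro ⟨h₁, h₂⟩
    obtain ⟨c₁, α, γ', hc₁, rfl⟩ := (rho_map_eq_zero_iff _).1 h₁
    obtain ⟨c₂, β, δ', hc₂, h⟩ := (rho_map_eq_zero_iff _).1 h₂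
    obtain ⟨x, s, γδ, hT⟩ := distinguished_cocone_triangle₁ (biprod.lift α β)
    let σ : ConeSplitting U₁ U₂ s := ⟨c₁, c₂, hc₁, hc₂, α, β, biprod.inl ≫ γδ, biprod.inr ≫ γδ,
      triangle_distinguished_of_iso hT (Iso.refl a) (Iso.refl _) (by simp) (by simp)
        (by ext <;> simp)⟩
    obtain ⟨f, hf⟩ := exists_shift_eq_comp_of_comp_eq_zero hT (biprod.desc γ' (-δ'))
      (by simp [h])
    have hs : uIso (U₁ ∩ U₂) s := by
      refine ⟨_, _, _, hT, ObjectProperty.ext_of_isTriangulatedClosed₂ _ _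
        (binaryBiproductTriangle_distinguished c₁ c₂) ?_ ?_⟩
      · exact hc₁.trans (Set.compl_subset_compl.2 Set.inter_subset_left)
      · exact hc₂.trans (Set.compl_subset_compl.2 Set.inter_subset_right)
    refine ⟨fracMor ⟨s, hs, f⟩, (hdel a b ⟨s, hs, f⟩ σ).1.trans ?_⟩
    have hγ : γ' = (biprod.inl ≫ γδ) ≫ f⟦(1 : ℤ)⟧' := by
      simpa using biprod.inl ≫= hf
    rw [hγ]
  · rintro ⟨m, rfl⟩
    obtain ⟨φ, rfl⟩ := exists_fracMor_eq m
    obtain ⟨σ⟩ := hsplit φ.s φ.hs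
    obtain ⟨h₁, h₂⟩ := hdel a b φ σ
    refine ⟨?_, ?_⟩
    · rw [h₁, rho_map_eq_zero_of_factors σ.supp₁]
    · rw [h₂, Functor.map_neg, rho_map_eq_zero_of_factors σ.supp₂, neg_zero]

lemma IsConnecting.exact_resDiff_delLeft
    (hsplit : ∀ ⦃x a : K⦄ (s : x ⟶ a), uIso (U₁ ∩ U₂) s → Nonempty (ConeSplitting U₁ U₂ s))
    (hdel : IsConnecting U₁ U₂ del) (a b : K) :
    Function.Exact (resDiff U₁ U₂ (a⟦(1 : ℤ)⟧) b) (delLeft U₁ U₂ del a b) := by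
  intro m
  rw [← hdel.exact_resDiff hsplit (a⟦(1 : ℤ)⟧) b m]
  change unshiftHom a b (del _ _ m) = 0 ↔ _
  exact ⟨fun h => by rw [← shift_unshiftHom (del _ _ m), h, Functor.map_zero],
    fun h => by rw [h, map_zero]⟩

/-- A morphism vanishes over `U₁` and over `U₂` if and only if its translate does, so exactness at
`Hom(a, b)` follows from exactness at `Hom(T a, T b)`. -/
lemma IsConnecting.exact_delLeft_resPair
    (hsplit : ∀ ⦃x a : K⦄ (s : x ⟶ a), uIso (U₁ ∩ U₂) s → Nonempty (ConeSplitting U₁ U₂ s))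
    (hdel : IsConnecting U₁ U₂ del) (a b : K) :
    Function.Exact (delLeft U₁ U₂ del a b) (resPair U₁ U₂ a b) := by
  intro f
  rw [resPair_eq_zero_iff, ← rho_map_shift_eq_zero_iff, ← rho_map_shift_eq_zero_iff (U := U₂),
    ← resPair_eq_zero_iff, hdel.exact_resPair hsplit (a⟦(1 : ℤ)⟧) b]
  refine exists_congr fun m => ⟨fun h => ?_, fun h => ?_⟩
  · change unshiftHom a b (del _ _ m) = f
    rw [h, unshiftHom_shift]
  · rw [← h]
    exact (shift_unshiftHom (del _ _ m)).symm

end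

end MayerVietoris

end TTGeometry

open TTGeometry in
theorem mainTheorem1 {K : Type*} [Category* K] [HasZeroObject K] [HasShift K ℤ]
    [Preadditive K] [∀ n : ℤ, (shiftFunctor K n).Additive] [Pretriangulated K] [IsTriangulated K]
    [MonoidalCategory K] [SymmetricCategory K] [TTGeometry.TensorTriangulated K]
    [TTGeometry.StronglyClosed K] [IsIdempotentComplete K]
    (U₁ U₂ : Set (TTGeometry.Spc K))
    (hU₁ : IsOpen U₁) (hU₁' : IsCompact U₁) (hU₂ : IsOpen U₂) (hU₂' : IsCompact U₂)
    (hcover : U₁ ∪ U₂ = Set.univ) :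
    (∀ (x a : K) (s : x ⟶ a), TTGeometry.uIso (U₁ ∩ U₂) s →
      Nonempty (TTGeometry.ConeSplitting U₁ U₂ s)) ∧
    (∃! del : ∀ a b : K, TTGeometry.Mor (U₁ ∩ U₂) a b →+ (a ⟶ b⟦(1 : ℤ)⟧),
      TTGeometry.IsConnecting U₁ U₂ del) ∧
    ∀ del : ∀ a b : K, TTGeometry.Mor (U₁ ∩ U₂) a b →+ (a ⟶ b⟦(1 : ℤ)⟧),
      TTGeometry.IsConnecting U₁ U₂ del →
        ∀ a b : K, TTGeometry.ExactLeft U₁ U₂ del a b ∧ TTGeometry.ExactRight U₁ U₂ del a b := by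
  have hsplit ⦃x a : K⦄ (s : x ⟶ a) (hs : uIso (U₁ ∩ U₂) s) :
      Nonempty (ConeSplitting U₁ U₂ s) :=
    nonempty_coneSplitting hU₁ hU₁' hU₂ hU₂' hcover hs
  have hd : Disjoint U₁ᶜ U₂ᶜ := by
    rw [Set.disjoint_compl_left_iff_subset, Set.compl_subset_iff_union, Set.union_comm, hcover]
  have h₁₂ ⦃c d : K⦄ (hc : supportedOn U₁ᶜ c) (hd' : supportedOn U₂ᶜ d) (f : c ⟶ d) : f = 0 :=
    hom_eq_zero_of_disjoint hd hc hd' f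
  have h₂₁ ⦃c d : K⦄ (hc : supportedOn U₂ᶜ c) (hd' : supportedOn U₁ᶜ d) (f : c ⟶ d) : f = 0 :=
    hom_eq_zero_of_disjoint hd.symm hc hd' f
  exact ⟨fun x a s hs => hsplit s hs, existsUnique_isConnecting hsplit h₁₂ h₂₁,
    fun del hdel a b => ⟨fun n => ⟨exact_resPair_resDiff hsplit h₁₂ h₂₁ _ _,
      hdel.exact_resDiff_delLeft hsplit _ _, hdel.exact_delLeft_resPair hsplit _ _⟩,
      fun n => ⟨exact_resPair_resDiff hsplit h₁₂ h₂₁ _ _, hdel.exact_resDiff hsplit _ _,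
        hdel.exact_resPair hsplit _ _⟩⟩⟩
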